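/- Let $\Gamma$ be a connected undirected graph (not necessarily finite or locally finite) without loops or double edges. Then $\Gamma$ is Gromov-hyperbolic if and only if its strong cop number $\operatorname{sCop}(\Gamma)$ is $1$. In particular, a finitely generated group $G$ is Gromov-hyperbolic if and only if $\operatorname{sCop}(G)=1$, where $\operatorname{sCop}(G):=\operatorname{sCop}(\operatorname{Cay}(G,S))$ for any finite generating set $S$ of $G$; explicitly, for every finite generating set $S$ of $G$, the group $G$ is Gromov-hyperbolic if and only if $\operatorname{sCop}(\operatorname{Cay}(G,S))=1$. Here $\Gamma$ is Gromov-hyperbolic if there is a $\delta$ such that all geodesic triangles in $\Gamma$ (three vertices joined pairwise by shortest edge paths) are $\delta$-slim, i.e. each side is contained in the $\delta$-neighbourhood of the union of the other two; a finitely generated group is Gromov-hyperbolic if its Cayley graphs with respect to finite generating sets are. The strong cop number is $$\operatorname{sCop}(\Gamma)=\inf\{n\ge 1:\ \forall v\in\Gamma\ \exists\sigma\ \forall\psi\ \exists\rho\ \forall R:\ \text{the cop player has a winning strategy with } n \text{ cops}\}\in\{1,2,\dots\}\cup\{\infty\},$$ where $v$ is a vertex, $\sigma,\psi,\rho,R$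 range over the positive integers, and $\inf\emptyset=\infty$. The game, a two-player game with perfect information, is as follows. The cop player chooses $n$ vertices as starting positions of the cops; then the robber chooses a starting vertex. In each stage, first every cop is moved along a path of length at most $\sigma$ to a vertex, and then the robber moves along a path of length at most $\psi$ to a vertex. The cop player wins if at some moment (at the start, after a cop move, or at any vertex along a path of the robber) the robber is at distance at most $\rho$ from some cop, or if from some stage on the robber never enters the closed ball of radius $R$ around $v$. -/

import Mathlib

namespace SimpleGraph

variable {V : Type*} (Γ : SimpleGraph V)

/-- A walk is geodesic if its length is the distance of its endpoints. -/
def Walk.IsGeodesic {Γ : SimpleGraph V} {x y : V} (p : Γ.Walk x y) : Prop :=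
  p.length = Γ.dist x y

/-- A connected graph is (Gromov-)hyperbolic if for some `δ` all geodesic triangles are `δ`-slim:
each side lies in the `δ`-neighbourhood of the union of the other two. (The quantification runs
over all triangles, so it suffices to mention one of the three sides.) -/
def IsHyperbolic : Prop :=
  ∃ δ : ℕ, ∀ (x y z : V) (p : Γ.Walk x y) (q : Γ.Walk y z) (r : Γ.Walk x z),
    p.IsGeodesic → q.IsGeodesic → r.IsGeodesic →
      ∀ w ∈ r.support, ∃ u, (u ∈ p.support ∨ u ∈ q.support) ∧ Γ.dist w u ≤ δ

/-- A strategy for `n` cops of speed `σ`. `pos h` are the positions of the cops in reaction to the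
finite sequence `h` of positions (in chronological order) that the robber has taken so far, so
`pos []` are the starting positions. Each cop moves by at most `σ` in each turn. -/
structure CopStrategy (n σ : ℕ) where
  pos : List V → Fin n → V
  legal : ∀ (h : List V) (x : V) (i : Fin n), Γ.dist (pos h i) (pos (h ++ [x]) i) ≤ σ

/-- The moves of a robber of speed `ψ` in an infinite play: the starting position is `pos 0`, and
in the `k`-th stage (`k = 0, 1, …`) the robber moves along `path k` from `pos k` to
`pos (k + 1)`. -/
structure RobberPlay (ψ : ℕ) where
  pos : ℕ → V
  path : ∀ k, Γ.Walk (pos k) (pos (k + 1))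
  length_le : ∀ k, (path k).length ≤ ψ

variable {Γ}

/-- The cop positions in the play in which the cops follow `s` and the robber moves as in `r`:
`s.play r 0` are the starting positions, and `s.play r (k + 1)` are the positions after the cop
move of the `k`-th stage, which may depend on `r.pos 0, …, r.pos k`. -/
def CopStrategy.play {n σ ψ : ℕ} (s : Γ.CopStrategy n σ) (r : Γ.RobberPlay ψ) (k : ℕ) :
    Fin n → V :=
  s.pos ((List.range k).map r.pos)

/-- The robber is captured by cops of reach `ρ`: at the start, or at some moment of some stage
(after the cop move, or at any vertex along the robber's path), the robber is at distance at most
`ρ` from a cop. -/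
def RobberPlay.IsCaptured {n σ ψ : ℕ} (r : Γ.RobberPlay ψ) (s : Γ.CopStrategy n σ) (ρ : ℕ) :
    Prop :=
  (∃ i, Γ.dist (r.pos 0) (s.play r 0 i) ≤ ρ) ∨
    ∃ k, ∃ w ∈ (r.path k).support, ∃ i, Γ.dist w (s.play r (k + 1) i) ≤ ρ

/-- From some stage on the robber never enters the closed ball of radius `R` around `v`. -/
def RobberPlay.EventuallyAvoids {ψ : ℕ} (r : Γ.RobberPlay ψ) (v : V) (R : ℕ) : Prop :=
  ∃ N, ∀ k ≥ N, ∀ w ∈ (r.path k).support, R < Γ.dist v w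

variable (Γ)

/-- There is a winning strategy for the cop player in the game with `n` cops, treasure `v`, cop
speed `σ`, robber speed `ψ`, cop reach `ρ` and robber radius `R`. -/
def CopsWin (n : ℕ) (v : V) (σ ψ ρ R : ℕ) : Prop :=
  ∃ s : Γ.CopStrategy n σ, ∀ r : Γ.RobberPlay ψ, r.IsCaptured s ρ ∨ r.EventuallyAvoids v R

/-- The strong cop number: the least `n ≥ 1` such that `n` cops win the strong game, and `⊤` if
there is none. All parameters range over the positive integers. -/
noncomputable def strongCopNumber : ℕ∞ :=
  sInf ((fun n : ℕ => (n : ℕ∞)) '' {n : ℕ | 1 ≤ n ∧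
    ∀ v : V, ∃ σ ≥ 1, ∀ ψ ≥ 1, ∃ ρ ≥ 1, ∀ R ≥ 1, Γ.CopsWin n v σ ψ ρ R})

end SimpleGraph

/-- A finitely generated group is (Gromov-)hyperbolic if its Cayley graphs with respect to finite
generating sets are hyperbolic. -/
def IsHyperbolicGroup (G : Type*) [Group G] : Prop :=
  ∀ S : Set G, S.Finite → Subgroup.closure S = ⊤ → (SimpleGraph.mulCayley S).IsHyperbolic

namespace SimpleGraph

/-! If triangles are `δ`-slim, the cop starts at `v` and in stage `k` moves to the `k`-th vertex of
a chosen geodesic from `v` to the robber. When the robber moves, slimness lets the cop pass to the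
new geodesic, one vertex further out, at speed `2 * δ + 1`. An uncaptured robber is always ahead of
the cop, so its distance from `v` tends to infinity.

Conversely, suppose one cop wins. If there were long closed walks all of whose segments up to a
certain length are geodesic, a fast robber could run on one of them forever: the two directions
diverge, so a slow cop cannot block both. The robber would stay in a bounded set, against the choice
of `R`. Hence long closed walks have shortcuts of bounded size (`exists_hasShortcuts`).

Shortcuts yield a linear isoperimetric inequality, where the area of a closed walk is replaced by
the integral of `f dg` for 1-Lipschitz `f` and `g` (`HasShortcuts.abs_integral_le`). So a detour
around a ball centred on a geodesic is quadratically long in the radius (`HasShortcuts.sq_le`). This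
gives the Morse lemma, and slimness follows by applying it to a path through a nearest-point
projection.

For groups, the property that one cop suffices is invariant under bi-Lipschitz change of the metric,
hence independent of the finite generating set. -/

/-! ### Distances along walks and geodesics -/

theorem Walk.dist_getVert_le {V : Type*} {Γ : SimpleGraph V} {x y : V} (p : Γ.Walk x y) {i j : ℕ}
    (h : i ≤ j) : Γ.dist (p.getVert i) (p.getVert j) ≤ j - i := by
  have hq := Γ.dist_le ((p.drop i).take (j - i))
  rw [Walk.take_length, Walk.drop_getVert, Nat.add_sub_cancel' h] at hq
  exact hq.trans (min_le_left _ _)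

theorem Walk.exists_subwalk {V : Type*} {Γ : SimpleGraph V} {x y : V} (p : Γ.Walk x y) {i j : ℕ}
    (h : i ≤ j) : ∃ q : Γ.Walk (p.getVert i) (p.getVert j),
      q.length ≤ j - i ∧ ∀ u ∈ q.support, u ∈ p.support := by
  have e : (p.drop i).getVert (j - i) = p.getVert j := by
    rw [Walk.drop_getVert, Nat.add_sub_cancel' h]
  refine ⟨((p.drop i).take (j - i)).copy rfl e, ?_, fun u hu => ?_⟩
  · rw [Walk.length_copy, Walk.take_length]
    exact min_le_left _ _
  · rw [Walk.support_copy] at hu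
    exact (p.isSubwalk_drop i).support_subset
      (((p.drop i).isSubwalk_take (j - i)).support_subset hu)

theorem Walk.exists_getVert {V : Type*} {Γ : SimpleGraph V} {x y u : V} {p : Γ.Walk x y}
    (hu : u ∈ p.support) : ∃ i ≤ p.length, p.getVert i = u := by
  obtain ⟨i, h1, h2⟩ := Walk.mem_support_iff_exists_getVert.1 hu
  exact ⟨i, h2, h1⟩

theorem Walk.IsGeodesic.dist_getVert {V : Type*} {Γ : SimpleGraph V} (hc : Γ.Connected) {x y : V}
    {p : Γ.Walk x y} (hp : p.IsGeodesic) {i j : ℕ} (h : i ≤ j) (hj : j ≤ p.length) :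
    Γ.dist (p.getVert i) (p.getVert j) = j - i := by
  have h1 := p.dist_getVert_le (Nat.zero_le i)
  have h2 := p.dist_getVert_le h
  have h3 := p.dist_getVert_le hj
  rw [Walk.getVert_zero] at h1
  rw [Walk.getVert_length] at h3
  have h4 := hc.dist_triangle (u := x) (v := p.getVert i) (w := y)
  have h5 := hc.dist_triangle (u := p.getVert i) (v := p.getVert j) (w := y)
  have h6 : p.length = Γ.dist x y := hp
  omega

theorem Walk.IsGeodesic.dist_left {V : Type*} {Γ : SimpleGraph V} (hc : Γ.Connected) {x y : V}
    {p : Γ.Walk x y} (hp : p.IsGeodesic) {i : ℕ} (hi : i ≤ p.length) :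
    Γ.dist x (p.getVert i) = i := by
  simpa using hp.dist_getVert hc (Nat.zero_le i) hi

theorem Walk.IsGeodesic.dist_right {V : Type*} {Γ : SimpleGraph V} (hc : Γ.Connected) {x y : V}
    {p : Γ.Walk x y} (hp : p.IsGeodesic) {i : ℕ} (hi : i ≤ p.length) :
    Γ.dist (p.getVert i) y = p.length - i := by
  simpa using hp.dist_getVert hc hi le_rfl

theorem Walk.dist_left_le {V : Type*} {Γ : SimpleGraph V} {x y u : V} {p : Γ.Walk x y}
    (hu : u ∈ p.support) : Γ.dist x u ≤ p.length := by
  obtain ⟨i, hi, rfl⟩ := Walk.exists_getVert hu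
  simpa using (p.dist_getVert_le (Nat.zero_le i)).trans (by omega)

theorem Walk.dist_right_le {V : Type*} {Γ : SimpleGraph V} {x y u : V} {p : Γ.Walk x y}
    (hu : u ∈ p.support) : Γ.dist u y ≤ p.length := by
  obtain ⟨i, hi, rfl⟩ := Walk.exists_getVert hu
  simpa using (p.dist_getVert_le hi).trans (by omega)

theorem strongCopNumber_eq_one_iff {V : Type*} (Γ : SimpleGraph V) :
    Γ.strongCopNumber = 1 ↔
      ∀ v : V, ∃ σ ≥ 1, ∀ ψ ≥ 1, ∃ ρ ≥ 1, ∀ R ≥ 1, Γ.CopsWin 1 v σ ψ ρ R := by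
  unfold strongCopNumber
  constructor
  · intro h
    have hne : ((fun n : ℕ => (n : ℕ∞)) '' {n : ℕ | 1 ≤ n ∧
        ∀ v : V, ∃ σ ≥ 1, ∀ ψ ≥ 1, ∃ ρ ≥ 1, ∀ R ≥ 1, Γ.CopsWin n v σ ψ ρ R}).Nonempty := by
      by_contra hn
      rw [Set.not_nonempty_iff_eq_empty] at hn
      rw [hn, sInf_empty] at h
      exact absurd h (by simp)
    have hm := csInf_mem hne
    rw [h] at hm
    obtain ⟨n, hn, h1⟩ := hm
    have : n = 1 := Nat.cast_eq_one.1 h1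
    subst this
    exact hn.2
  · intro h
    apply le_antisymm
    · exact sInf_le ⟨1, ⟨le_rfl, h⟩, by simp⟩
    · apply le_sInf
      rintro _ ⟨n, hn, rfl⟩
      exact (Nat.one_le_cast.2 hn.1 : (1 : ℕ∞) ≤ (n : ℕ∞))

/-! ### Hyperbolic graphs: one cop wins by chasing along geodesics -/

/-- The cop chases the robber along the chosen paths `γ x`: in the `t`-th step it moves to the
`t`-th vertex of the path to the robber's position if its speed permits. -/
noncomputable def chaseStep {V : Type*} (Γ : SimpleGraph V) (σ : ℕ) (γ : V → ℕ → V)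
    (c : V × ℕ) (x : V) : V × ℕ :=
  open Classical in (if Γ.dist c.1 (γ x c.2) ≤ σ then γ x c.2 else c.1, c.2 + 1)

/-- The strategy of one cop that starts at `v` and moves according to `chaseStep`. -/
noncomputable def chase {V : Type*} (Γ : SimpleGraph V) (σ : ℕ) (γ : V → ℕ → V) (v : V) :
    Γ.CopStrategy 1 σ where
  pos h _ := (h.foldl (Γ.chaseStep σ γ) (v, 0)).1
  legal h x i := by
    rw [List.foldl_append]
    simp only [List.foldl_cons, List.foldl_nil, chaseStep]
    split_ifs with hd
    · exact hd
    · simp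

theorem chase_snd {V : Type*} (Γ : SimpleGraph V) (σ : ℕ) (γ : V → ℕ → V) (v : V) (f : ℕ → V)
    (k : ℕ) : (((List.range k).map f).foldl (Γ.chaseStep σ γ) (v, 0)).2 = k := by
  induction k with
  | zero => rfl
  | succ k ih =>
    rw [List.range_succ, List.map_append, List.foldl_append]
    simp [chaseStep, ih]

theorem chase_play_zero {V : Type*} (Γ : SimpleGraph V) (σ ψ : ℕ) (γ : V → ℕ → V) (v : V)
    (r : Γ.RobberPlay ψ) (i : Fin 1) : (Γ.chase σ γ v).play r 0 i = v := rfl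

theorem chase_play_succ {V : Type*} (Γ : SimpleGraph V) (σ ψ : ℕ) (γ : V → ℕ → V) (v : V)
    (r : Γ.RobberPlay ψ) (k : ℕ) (i : Fin 1)
    (h : Γ.dist ((Γ.chase σ γ v).play r k i) (γ (r.pos k) k) ≤ σ) :
    (Γ.chase σ γ v).play r (k + 1) i = γ (r.pos k) k := by
  have e := chase_snd Γ σ γ v r.pos k
  simp only [CopStrategy.play, chase] at h ⊢
  rw [List.range_succ, List.map_append, List.foldl_append]
  simp only [List.map_cons, List.map_nil, List.foldl_cons, List.foldl_nil, chaseStep]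
  rw [e, if_pos h]

theorem IsHyperbolic.strongCopNumber_eq_one {V : Type*} {Γ : SimpleGraph V} (hc : Γ.Connected)
    (hΓ : Γ.IsHyperbolic) : Γ.strongCopNumber = 1 := by
  rw [strongCopNumber_eq_one_iff]
  intro v
  obtain ⟨δ, hδ⟩ := hΓ
  choose γ hγ using fun x => hc.exists_walk_length_eq_dist v x
  have hg : ∀ x, (γ x).IsGeodesic := hγ
  -- Changing geodesics costs `δ` by slimness, and the shift along the new one at most `δ + 1`. The
  -- reach `ψ + δ` excludes that the slim point lies on the robber's own side of the triangle.
  refine ⟨2 * δ + 1, by omega, fun ψ hψ => ⟨ψ + δ, by omega, fun R _ =>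
    ⟨Γ.chase (2 * δ + 1) (fun x => (γ x).getVert) v, fun r => ?_⟩⟩⟩
  rw [or_iff_not_imp_left]
  intro hcap
  set s := Γ.chase (2 * δ + 1) (fun x => (γ x).getVert) v with hs
  have hfar : ∀ k, ψ + δ < Γ.dist (r.pos k) (s.play r (k + 1) 0) := by
    intro k
    by_contra hk
    exact hcap (Or.inr ⟨k, r.pos k, Walk.start_mem_support _, 0, by omega⟩)
  have key : ∀ k, s.play r (k + 1) 0 = (γ (r.pos k)).getVert k →
      k + (ψ + δ) < Γ.dist v (r.pos k) := by
    intro k hk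
    have h1 := hfar k
    rw [hk, dist_comm] at h1
    rcases le_or_gt k (γ (r.pos k)).length with h | h
    · rw [(hg _).dist_right hc h] at h1
      rw [← hγ]
      omega
    -- Past the end of the geodesic `getVert` is constant, so the cop would stand on the robber.
    · rw [Walk.getVert_of_length_le _ h.le, dist_self] at h1
      omega
  have inv : ∀ k, s.play r (k + 1) 0 = (γ (r.pos k)).getVert k := by
    intro k
    induction k with
    | zero =>
      refine chase_play_succ Γ _ _ _ v r 0 0 ?_
      rw [chase_play_zero, Walk.getVert_zero, dist_self]
      omega
    | succ k ih =>
      refine chase_play_succ Γ _ _ _ v r (k + 1) 0 ?_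
      rw [← hs, ih]
      have h1 := key k ih
      obtain ⟨q, hq⟩ := hc.exists_walk_length_eq_dist (r.pos (k + 1)) (r.pos k)
      have hqψ : q.length ≤ ψ := by
        rw [hq, dist_comm]
        exact (Γ.dist_le (r.path k)).trans (r.length_le k)
      have hkl : k ≤ (γ (r.pos k)).length := by rw [hγ]; omega
      obtain ⟨u, hu, hwu⟩ := hδ v (r.pos (k + 1)) (r.pos k) (γ _) q (γ _) (hg _) hq (hg _)
        ((γ (r.pos k)).getVert k) (Walk.getVert_mem_support _ _)
      -- On the new geodesic the slim point has an index `i` with `|i - k| ≤ δ`. On `q` it would put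
      -- the cop within `ψ + δ` of the robber.
      rcases hu with hu | hu
      · obtain ⟨i, hi, rfl⟩ := Walk.exists_getVert hu
        have h2 := (hg _).dist_left hc hi
        have h3 := (hg _).dist_left hc hkl
        have h4 := hc.dist_triangle (u := v) (v := (γ (r.pos k)).getVert k)
          (w := (γ (r.pos (k + 1))).getVert i)
        have h5 := hc.dist_triangle (u := v) (v := (γ (r.pos (k + 1))).getVert i)
          (w := (γ (r.pos k)).getVert k)
        rw [dist_comm (u := (γ (r.pos (k + 1))).getVert i)] at h5
        have h6 := hc.dist_triangle (u := (γ (r.pos k)).getVert k)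
          (v := (γ (r.pos (k + 1))).getVert i) (w := (γ (r.pos (k + 1))).getVert (k + 1))
        rcases le_total i (k + 1) with h | h
        · have h7 := (γ (r.pos (k + 1))).dist_getVert_le h
          omega
        · have h7 := (γ (r.pos (k + 1))).dist_getVert_le h
          rw [dist_comm] at h7
          omega
      · have h2 := Walk.dist_right_le hu
        have h3 := hc.dist_triangle (u := (γ (r.pos k)).getVert k) (v := u) (w := r.pos k)
        rw [(hg _).dist_right hc hkl, hγ] at h3
        omega
  refine ⟨R, fun k hk w hw => ?_⟩
  have h1 := key k (inv k)
  have h2 := Walk.dist_left_le hw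
  have h3 := r.length_le k
  have h4 := hc.dist_triangle (u := v) (v := w) (w := r.pos k)
  rw [dist_comm (u := w)] at h4
  omega

/-! ### Bi-Lipschitz invariance -/

/-- The same cop positions work after rescaling: a robber in `Γ'` is simulated in `Γ` by joining its
successive positions by geodesics. A capture inside such a geodesic is charged to its starting
vertex, hence the extra `C * ψ` in the reach. -/
theorem strongCopNumber_eq_one_of_dist_le {V : Type*} {Γ Γ' : SimpleGraph V} (hc : Γ.Connected)
    (hc' : Γ'.Connected) {C : ℕ} (hC : 1 ≤ C) (h₁ : ∀ u v, Γ'.dist u v ≤ C * Γ.dist u v)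
    (h₂ : ∀ u v, Γ.dist u v ≤ C * Γ'.dist u v) (h : Γ.strongCopNumber = 1) :
    Γ'.strongCopNumber = 1 := by
  rw [strongCopNumber_eq_one_iff] at h ⊢
  intro v
  obtain ⟨σ, hσ, h⟩ := h v
  refine ⟨C * σ, Nat.mul_pos hC hσ, fun ψ hψ => ?_⟩
  obtain ⟨ρ, hρ, h⟩ := h (C * ψ) (Nat.mul_pos hC hψ)
  refine ⟨C * (C * ψ + ρ), Nat.mul_pos hC (by omega), fun R hR => ?_⟩
  obtain ⟨s, hs⟩ := h (C * (R + ψ)) (Nat.mul_pos hC (by omega))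
  refine ⟨⟨s.pos, fun l x i => (h₁ _ _).trans (Nat.mul_le_mul_left C (s.legal l x i))⟩,
    fun r => ?_⟩
  choose q hq using fun k => hc.exists_walk_length_eq_dist (r.pos k) (r.pos (k + 1))
  have hstep : ∀ k, (q k).length ≤ C * ψ := fun k => by
    rw [hq]
    exact (h₂ _ _).trans (Nat.mul_le_mul_left C ((Γ'.dist_le (r.path k)).trans (r.length_le k)))
  rcases hs ⟨r.pos, q, hstep⟩ with hcap | ⟨N, hN⟩
  · left
    rcases hcap with ⟨i, hi⟩ | ⟨k, w, hw, i, hi⟩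
    · exact Or.inl ⟨i, (h₁ _ _).trans (Nat.mul_le_mul_left C (hi.trans (by omega)))⟩
    · refine Or.inr ⟨k, r.pos k, Walk.start_mem_support _, i,
        (h₁ _ _).trans (Nat.mul_le_mul_left C ?_)⟩
      exact hc.dist_triangle.trans (add_le_add ((Walk.dist_left_le hw).trans (hstep k)) hi)
  · refine Or.inr ⟨N, fun k hk w hw => ?_⟩
    have h3 := (hN k hk (r.pos k) (Walk.start_mem_support _)).trans_le (h₂ _ _)
    have h4 := Nat.lt_of_mul_lt_mul_left h3
    have h5 := hc'.dist_triangle (u := v) (v := w) (w := r.pos k)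
    have h6 := (Walk.dist_left_le hw).trans (r.length_le k)
    rw [dist_comm (u := w)] at h5
    omega

/-! ### Discrete integrals and the isoperimetric inequality -/

/-- The discrete line integral of `f dg` along a walk: the sum of `f u * (g v - g u)`
over its darts `(u, v)`. -/
def Walk.integral {V : Type*} {Γ : SimpleGraph V} (f g : V → ℤ) :
    ∀ {x y : V}, Γ.Walk x y → ℤ
  | _, _, .nil => 0
  | x, _, .cons (v := u) _ p => f x * (g u - g x) + p.integral f g

theorem Walk.integral_append {V : Type*} {Γ : SimpleGraph V} (f g : V → ℤ) {x y z : V}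
    (p : Γ.Walk x y) (q : Γ.Walk y z) :
    (p.append q).integral f g = p.integral f g + q.integral f g := by
  induction p with
  | nil => simp [integral]
  | cons h p ih => simp [integral, ih, add_assoc]

theorem Walk.abs_sub_le {V : Type*} {Γ : SimpleGraph V} {f : V → ℤ}
    (hf : ∀ u v, Γ.Adj u v → |f u - f v| ≤ 1) {x y : V} (p : Γ.Walk x y) :
    |f x - f y| ≤ p.length := by
  induction p with
  | nil => simp
  | @cons u v w h p ih =>
    have := _root_.abs_sub_le (f u) (f v) (f w)
    have := hf _ _ h
    push_cast [Walk.length_cons]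
    linarith

/-- The main term depends only on the endpoints, so exchanging a short segment for another one
changes the integral by a bounded amount. -/
theorem Walk.abs_integral_sub_le {V : Type*} {Γ : SimpleGraph V} {f g : V → ℤ}
    (hf : ∀ u v, Γ.Adj u v → |f u - f v| ≤ 1) (hg : ∀ u v, Γ.Adj u v → |g u - g v| ≤ 1) {x y : V}
    (p : Γ.Walk x y) : |p.integral f g - f x * (g y - g x)| ≤ (p.length : ℤ) ^ 2 := by
  induction p with
  | nil => simp [integral]
  | @cons u v w h p ih =>
    have e : (cons h p).integral f g - f u * (g w - g u) =
        (p.integral f g - f v * (g w - g v)) + (f v - f u) * (g w - g v) := by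
      simp only [integral]
      ring
    have h1 : |(f v - f u) * (g w - g v)| ≤ 1 * p.length := by
      rw [abs_mul]
      refine mul_le_mul (hf _ _ h.symm) ?_ (abs_nonneg _) zero_le_one
      rw [abs_sub_comm]
      exact p.abs_sub_le hg
    rw [e]
    refine (abs_add_le _ _).trans ?_
    push_cast [Walk.length_cons]
    nlinarith

theorem Walk.integral_eq_zero_of_left {V : Type*} {Γ : SimpleGraph V} {f g : V → ℤ} {x y : V}
    (p : Γ.Walk x y) (h : ∀ u ∈ p.support, f u = 0) : p.integral f g = 0 := by
  induction p with
  | nil => rfl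
  | cons _ p ih =>
    rw [integral, h _ (start_mem_support _),
      ih fun u hu => h u (by rw [support_cons]; exact List.mem_cons_of_mem _ hu)]
    simp

theorem Walk.integral_eq_zero_of_right {V : Type*} {Γ : SimpleGraph V} {f g : V → ℤ} {x y : V}
    (p : Γ.Walk x y) {c : ℤ} (h : ∀ u ∈ p.support, g u = c) : p.integral f g = 0 := by
  induction p with
  | nil => rfl
  | cons _ p ih =>
    have h' : ∀ u ∈ p.support, g u = c := fun u hu =>
      h u (by rw [support_cons]; exact List.mem_cons_of_mem _ hu)
    rw [integral, h _ (start_mem_support _), h' _ (start_mem_support _), ih h']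
    simp

theorem Walk.integral_eq_sum {V : Type*} {Γ : SimpleGraph V} (f g : V → ℤ) {x y : V}
    (p : Γ.Walk x y) : p.integral f g = ∑ i ∈ Finset.range p.length,
      f (p.getVert i) * (g (p.getVert (i + 1)) - g (p.getVert i)) := by
  induction p with
  | nil => rfl
  | cons _ p ih =>
    rw [length_cons, Finset.sum_range_succ', integral, ih, add_comm]
    simp

/-- Every closed walk longer than `K` has, up to rotation, an initial segment of length at most
`K` that is not geodesic. -/
def HasShortcuts {V : Type*} (Γ : SimpleGraph V) (K : ℕ) : Prop :=
  ∀ (x : V) (p : Γ.Walk x x), K < p.length → ∃ i k, k ≤ K ∧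
    Γ.dist (p.getVert i) (((p.drop i).append (p.take i)).getVert k) < k

/-- Each shortcut reduces the length by at least 1 and changes the integral by at most `2 * K ^ 2`,
since the old and the new segment have length at most `K`. -/
theorem HasShortcuts.abs_integral_le {V : Type*} {Γ : SimpleGraph V} (hc : Γ.Connected) {K : ℕ}
    (hK : Γ.HasShortcuts K) {f g : V → ℤ}
    (hf : ∀ u v, Γ.Adj u v → |f u - f v| ≤ 1) (hg : ∀ u v, Γ.Adj u v → |g u - g v| ≤ 1)
    {x : V} (p : Γ.Walk x x) : |p.integral f g| ≤ 2 * (K : ℤ) ^ 2 * p.length := by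
  induction hn : p.length using Nat.strong_induction_on generalizing x with
  | _ n ih =>
  rcases le_or_gt n K with hle | hlt
  · have h1 := p.abs_integral_sub_le hf hg
    rw [sub_self, mul_zero, sub_zero, hn] at h1
    have h2 : (n : ℤ) ≤ K := by exact_mod_cast hle
    rcases Nat.eq_zero_or_pos n with rfl | hpos
    · simpa using h1
    · have h3 : (1 : ℤ) ≤ n := by exact_mod_cast hpos
      nlinarith
  · obtain ⟨i, k, hk, hd⟩ := hK x p (hn ▸ hlt)
    set q := (p.drop i).append (p.take i) with hq
    have hql : q.length = n := by
      rw [hq, Walk.length_append, Walk.drop_length, Walk.take_length]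
      omega
    have hqi : q.integral f g = p.integral f g := by
      rw [hq, Walk.integral_append, add_comm, ← Walk.integral_append, Walk.append_take_drop_eq]
    have hsplit := q.append_take_drop_eq k
    obtain ⟨a, ha⟩ := hc.exists_walk_length_eq_dist (p.getVert i) (q.getVert k)
    have hl : (q.drop k).length = n - k := by rw [Walk.drop_length, hql]
    have ht : (q.take k).length = k := by rw [Walk.take_length, hql]; omega
    have h1 := ih (a.append (q.drop k)).length (by rw [Walk.length_append]; omega)
      (a.append (q.drop k)) rfl
    have h2 := (q.take k).abs_integral_sub_le hf hg
    have h3 := a.abs_integral_sub_le hf hg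
    have h4 : q.integral f g = (q.take k).integral f g + (q.drop k).integral f g := by
      rw [← Walk.integral_append, hsplit]
    rw [Walk.integral_append, Walk.length_append, hl] at h1
    have h5 : (a.length : ℤ) ≤ K := by exact_mod_cast (by omega : a.length ≤ K)
    have h6 : (k : ℤ) ≤ K := by exact_mod_cast hk
    have h7 : (((a.length + (n - k) : ℕ)) : ℤ) ≤ n - 1 := by omega
    rw [ht] at h2
    have h8 : (a.length : ℤ) ^ 2 ≤ (K : ℤ) ^ 2 := by gcongr
    have h9 : (k : ℤ) ^ 2 ≤ (K : ℤ) ^ 2 := by gcongr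
    have h10 : 2 * (K : ℤ) ^ 2 * ((a.length + (n - k) : ℕ) : ℤ) ≤ 2 * (K : ℤ) ^ 2 * (n - 1) :=
      mul_le_mul_of_nonneg_left h7 (by positivity)
    rw [← hqi, h4]
    rw [abs_le] at *
    constructor <;> linarith [h1.1, h1.2, h2.1, h2.2, h3.1, h3.2]

/-- A walk between two points of a geodesic that avoids a large ball around a point of the geodesic
between them is at least quadratically long in the radius of the ball. -/
theorem HasShortcuts.sq_le {V : Type*} {Γ : SimpleGraph V} (hc : Γ.Connected) {K : ℕ}
    (hK : Γ.HasShortcuts K) {a b p : V} (hp : Γ.dist a b = Γ.dist a p + Γ.dist p b)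
    (q : Γ.Walk b a) {m : ℕ} (hq : ∀ u ∈ q.support, 2 * m ≤ Γ.dist u p) :
    m ^ 2 ≤ 2 * K ^ 2 * (Γ.dist a b + q.length) := by
  obtain ⟨s, hs⟩ := hc.exists_walk_length_eq_dist a p
  obtain ⟨t, ht⟩ := hc.exists_walk_length_eq_dist p b
  have hsg : s.IsGeodesic := hs
  -- `f` is a bump around `p` that vanishes on `q`, and `g` is constant on `t`, so only `s`
  -- contributes to the integral.
  set f : V → ℤ := fun u => max 0 (2 * m - Γ.dist u p) with hf
  set g : V → ℤ := fun u => min (Γ.dist a u : ℤ) (Γ.dist a p) with hg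
  have hf1 : ∀ u v, Γ.Adj u v → |f u - f v| ≤ 1 := by
    intro u v h
    have h1 := dist_eq_one_iff_adj.2 h
    have h2 := hc.dist_triangle (u := u) (v := v) (w := p)
    have h3 := hc.dist_triangle (u := v) (v := u) (w := p)
    rw [dist_comm] at h1
    have h4 := dist_eq_one_iff_adj.2 h
    simp only [hf]
    rw [abs_le]
    omega
  have hg1 : ∀ u v, Γ.Adj u v → |g u - g v| ≤ 1 := by
    intro u v h
    have h1 := dist_eq_one_iff_adj.2 h
    have h2 := hc.dist_triangle (u := a) (v := u) (w := v)
    have h3 := hc.dist_triangle (u := a) (v := v) (w := u)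
    rw [dist_comm (u := v)] at h3
    simp only [hg]
    rw [abs_le]
    omega
  have htot := hK.abs_integral_le hc hf1 hg1 (s.append (t.append q))
  have hq0 : q.integral f g = 0 := q.integral_eq_zero_of_left fun u hu => by
    have := hq u hu
    simp only [hf]
    omega
  have ht0 : t.integral f g = 0 := t.integral_eq_zero_of_right (c := Γ.dist a p) fun u hu => by
    have h1 := Walk.dist_right_le hu
    have h2 := hc.dist_triangle (u := a) (v := u) (w := b)
    simp only [hg]
    obtain ⟨i, hi, rfl⟩ := Walk.exists_getVert hu
    have h3 := Walk.IsGeodesic.dist_right hc (p := t) ht hi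
    omega
  have hms : 2 * m ≤ s.length := by
    rw [hs]
    exact hq a (Walk.end_mem_support _)
  have hs0 : (m : ℤ) ^ 2 ≤ s.integral f g := by
    rw [Walk.integral_eq_sum]
    have hterm : ∀ i ∈ Finset.range s.length,
        f (s.getVert i) * (g (s.getVert (i + 1)) - g (s.getVert i)) =
          max 0 (2 * m - ((s.length - i : ℕ) : ℤ)) := by
      intro i hi
      have hi' := Finset.mem_range.1 hi
      have h1 := hsg.dist_left hc hi'.le
      have h2 := hsg.dist_left hc (i := i + 1) hi'
      have h3 := hsg.dist_right hc hi'.le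
      have h4 : g (s.getVert (i + 1)) - g (s.getVert i) = 1 := by
        simp only [hg]
        omega
      rw [h4, mul_one]
      simp only [hf]
      rw [h3]
    rw [Finset.sum_congr rfl hterm]
    -- On the last `m` edges of `s` the bump is at least `m`, and `g` grows by 1 along each edge.
    calc (m : ℤ) ^ 2 = ∑ i ∈ Finset.Ico (s.length - m) s.length, (m : ℤ) := by
          rw [Finset.sum_const, Nat.card_Ico, nsmul_eq_mul, sq]
          congr 2
          omega
      _ ≤ ∑ i ∈ Finset.Ico (s.length - m) s.length, max 0 (2 * m - ((s.length - i : ℕ) : ℤ)) := by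
          refine Finset.sum_le_sum fun i hi => ?_
          have := Finset.mem_Ico.1 hi
          omega
      _ ≤ _ := by
          refine Finset.sum_le_sum_of_subset_of_nonneg (fun i hi => ?_)
            fun i _ _ => le_max_left _ _
          exact Finset.mem_range.2 (Finset.mem_Ico.1 hi).2
  rw [Walk.integral_append, Walk.integral_append, hq0, ht0, Walk.length_append,
    Walk.length_append, hs, ht] at htot
  have := hs0.trans ((le_abs_self _).trans (by simpa using htot))
  rw [hp, add_assoc]
  exact_mod_cast this

/-! ### A robber evading one cop on a local geodesic -/

theorem exists_walk_along {V : Type*} {Γ : SimpleGraph V} {c : ℤ → V}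
    (hc : ∀ i, Γ.Adj (c i) (c (i + 1))) (t : ℤ) {e : ℤ} (he : e = 1 ∨ e = -1) (m : ℕ) :
    ∃ q : Γ.Walk (c t) (c (t + e * m)), q.length = m ∧
      ∀ w ∈ q.support, ∃ i ≤ m, w = c (t + e * i) := by
  induction m with
  | zero => exact ⟨Walk.nil.copy rfl (by simp), by simp, fun w hw => ⟨0, le_rfl, by simpa using hw⟩⟩
  | succ m ih =>
    obtain ⟨q, hq, hs⟩ := ih
    have h : Γ.Adj (c (t + e * m)) (c (t + e * (m + 1 : ℕ))) := by
      rcases he with rfl | rfl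
      · convert hc (t + 1 * m) using 2
        push_cast
        ring
      · convert (hc (t + -1 * (m + 1 : ℕ))).symm using 2
        push_cast
        ring
    refine ⟨q.concat h, by rw [Walk.length_concat, hq], fun w hw => ?_⟩
    rw [Walk.support_concat, List.mem_append, List.mem_singleton] at hw
    rcases hw with hw | rfl
    · obtain ⟨i, hi, rfl⟩ := hs w hw
      exact ⟨i, by omega, rfl⟩
    · exact ⟨m + 1, le_rfl, rfl⟩

/-- On a local geodesic `c`, a robber that is far from the cop has a direction in which it stays
away from the cop for a long time, and ends up far from the cop. -/
theorem exists_escape_direction {V : Type*} {Γ : SimpleGraph V} (hconn : Γ.Connected) {c : ℤ → V}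
    {L : ℕ} (hc : ∀ i j : ℤ, i ≤ j → j ≤ i + 2 * L → (Γ.dist (c i) (c j) : ℤ) = j - i) {A b : ℕ}
    (hA : 3 * b < A) (x : V) (t : ℤ) : ∃ e : ℤ, (e = 1 ∨ e = -1) ∧
      (A ≤ Γ.dist x (c t) → (∀ i : ℕ, i ≤ L → b < Γ.dist x (c (t + e * i))) ∧
        L ≤ Γ.dist x (c (t + e * L))) := by
  have hpair : ∀ i j : ℕ, i ≤ L → j ≤ L →
      i + j ≤ Γ.dist x (c (t + 1 * i)) + Γ.dist x (c (t + -1 * j)) := by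
    intro i j hi hj
    have h1 := hc (t + -1 * j) (t + 1 * i) (by omega) (by omega)
    have h2 := hconn.dist_triangle (u := c (t + -1 * j)) (v := x) (w := c (t + 1 * i))
    rw [dist_comm (v := x)] at h2
    omega
  have hstart : ∀ e : ℤ, (e = 1 ∨ e = -1) → ∀ i : ℕ, i ≤ L →
      Γ.dist x (c t) ≤ Γ.dist x (c (t + e * i)) + i := by
    rintro e (rfl | rfl) i hi
    · have h1 := hc t (t + 1 * i) (by omega) (by omega)
      have h2 := hconn.dist_triangle (u := x) (v := c (t + 1 * i)) (w := c t)
      rw [dist_comm (u := c (t + 1 * i))] at h2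
      omega
    · have h1 := hc (t + -1 * i) t (by omega) (by omega)
      have h2 := hconn.dist_triangle (u := x) (v := c (t + -1 * i)) (w := c t)
      omega
  -- If the cop is within `b` of a vertex `i` steps ahead, then `i ≥ A - b > 2 * b`, and by `hpair`
  -- the opposite direction is safe. If neither side is threatened, the direction with the farther
  -- end is taken.
  by_cases hp : ∃ i : ℕ, i ≤ L ∧ Γ.dist x (c (t + 1 * i)) ≤ b
  · obtain ⟨i, hi, hib⟩ := hp
    refine ⟨-1, Or.inr rfl, fun h => ?_⟩
    have h1 := hstart 1 (Or.inl rfl) i hi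
    exact ⟨fun j hj => by have := hpair i j hi hj; omega, by have := hpair i L hi le_rfl; omega⟩
  by_cases hm : ∃ i : ℕ, i ≤ L ∧ Γ.dist x (c (t + -1 * i)) ≤ b
  · obtain ⟨i, hi, hib⟩ := hm
    refine ⟨1, Or.inl rfl, fun h => ?_⟩
    have h1 := hstart (-1) (Or.inr rfl) i hi
    exact ⟨fun j hj => by have := hpair j i hj hi; omega, by have := hpair L i le_rfl hi; omega⟩
  push Not at hp hm
  have h1 := hpair L L le_rfl le_rfl
  rcases le_total (Γ.dist x (c (t + 1 * L))) (Γ.dist x (c (t + -1 * L))) with h | h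
  · exact ⟨-1, Or.inr rfl, fun _ => ⟨hm, by omega⟩⟩
  · exact ⟨1, Or.inl rfl, fun _ => ⟨hp, by omega⟩⟩

/-- The history, the position and the direction of a robber that runs along `c` with speed `ψ` and
chooses a new direction, depending on the positions of cop and robber, every `T` stages. -/
def evade {V : Type*} {Γ : SimpleGraph V} {σ : ℕ} (s : Γ.CopStrategy 1 σ) (c : ℤ → V) (ψ T : ℕ)
    (dir : V → ℤ → ℤ) (t : ℤ) : ℕ → List V × ℤ × ℤ
  | 0 => ([], t, dir (s.pos [] 0) t)
  | k + 1 =>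
    let a := evade s c ψ T dir t k
    (a.1 ++ [c a.2.1], a.2.1 + a.2.2 * ψ,
      if T ∣ k + 1 then dir (s.pos (a.1 ++ [c a.2.1]) 0) (a.2.1 + a.2.2 * ψ) else a.2.2)

theorem evade_fst {V : Type*} {Γ : SimpleGraph V} {σ : ℕ} (s : Γ.CopStrategy 1 σ) (c : ℤ → V)
    (ψ T : ℕ) (dir : V → ℤ → ℤ) (t : ℤ) (k : ℕ) : (evade s c ψ T dir t k).1 =
      (List.range k).map fun j => c (evade s c ψ T dir t j).2.1 := by
  induction k with
  | zero => rfl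
  | succ k ih => rw [List.range_succ, List.map_append, ← ih]; rfl

theorem CopStrategy.dist_play_le {V : Type*} {Γ : SimpleGraph V} (hconn : Γ.Connected) {n σ ψ : ℕ}
    (s : Γ.CopStrategy n σ) (r : Γ.RobberPlay ψ) (i : Fin n) (k j : ℕ) :
    Γ.dist (s.play r k i) (s.play r (k + j) i) ≤ j * σ := by
  induction j with
  | zero => simp
  | succ j ih =>
    have h1 : Γ.dist (s.play r (k + j) i) (s.play r (k + j + 1) i) ≤ σ := by
      unfold play
      rw [List.range_succ, List.map_append]
      exact s.legal _ _ _
    have h2 := hconn.dist_triangle (u := s.play r k i) (v := s.play r (k + j) i)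
      (w := s.play r (k + j + 1) i)
    rw [← add_assoc, add_mul]
    omega

/-- The robber plays rounds of `T` stages in a fixed direction. The cop moves by at most `T * σ`
during a round, so avoiding its initial position by `ρ + T * σ` suffices; ending `T * ψ` away from
that position restores the distance `T * ψ - T * σ` for the next round. -/
theorem CopStrategy.exists_evasion {V : Type*} {Γ : SimpleGraph V} (hconn : Γ.Connected)
    {σ ψ ρ T : ℕ} (s : Γ.CopStrategy 1 σ) (hT : 0 < T)
    (hψ : 3 * (ρ + T * σ) + T * σ < T * ψ) {c : ℤ → V}
    (hc : ∀ i j : ℤ, i ≤ j → j ≤ i + 2 * (T * ψ : ℕ) → (Γ.dist (c i) (c j) : ℤ) = j - i) :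
    ∃ r : Γ.RobberPlay ψ, ¬ r.IsCaptured s ρ ∧ ∀ k, r.pos k ∈ Set.range c := by
  have hadj : ∀ i, Γ.Adj (c i) (c (i + 1)) := by
    intro i
    have := hc i (i + 1) (by omega) (by omega)
    exact dist_eq_one_iff_adj.1 (by omega)
  choose dir hdir hesc using exists_escape_direction hconn hc
    (A := T * ψ - T * σ) (b := ρ + T * σ) (by omega)
  -- The cop cannot be near both of two vertices at distance `2 * (T * ψ)`.
  obtain ⟨t, ht⟩ : ∃ t, T * ψ - T * σ ≤ Γ.dist (s.pos [] 0) (c t) := by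
    by_contra! h
    have h1 := h 0
    have h2 := h (2 * (T * ψ : ℕ))
    have h3 := hc 0 (2 * (T * ψ : ℕ)) (by omega) (by omega)
    have h4 := hconn.dist_triangle (u := c 0) (v := s.pos [] 0) (w := c (2 * (T * ψ : ℕ)))
    rw [dist_comm (v := s.pos [] 0)] at h4
    omega
  let idx : ℕ → ℤ := fun k => (evade s c ψ T dir t k).2.1
  let drn : ℕ → ℤ := fun k => (evade s c ψ T dir t k).2.2
  have hidx : ∀ k, idx (k + 1) = idx k + drn k * ψ := fun k => rfl
  have hdrn : ∀ k, ¬ T ∣ k + 1 → drn (k + 1) = drn k := fun k hk => if_neg hk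
  have hd1 : ∀ k, drn k = 1 ∨ drn k = -1 := by
    intro k
    induction k with
    | zero => exact hdir _ _
    | succ k ih =>
      by_cases h : T ∣ k + 1
      · have : drn (k + 1) = dir _ _ := if_pos h
        rw [this]
        exact hdir _ _
      · rw [hdrn k h]
        exact ih
  choose q hql hqs using fun k => exists_walk_along hadj (idx k) (hd1 k) ψ
  let r : Γ.RobberPlay ψ := ⟨fun k => c (idx k), q, fun k => (hql k).le⟩
  have hplay : ∀ k, s.play r k = s.pos (evade s c ψ T dir t k).1 := by
    intro k
    rw [evade_fst]
    rfl
  have hturn : ∀ k, T ∣ k → drn k = dir (s.play r k 0) (idx k) := by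
    intro k hk
    rw [hplay]
    cases k with
    | zero => rfl
    | succ k => exact if_pos hk
  have hrun : ∀ m j, j < T → idx (T * m + j) = idx (T * m) + drn (T * m) * (j * ψ : ℕ) ∧
      drn (T * m + j) = drn (T * m) := by
    intro m j
    induction j with
    | zero => intro _; simp
    | succ j ih =>
      intro hj
      obtain ⟨h1, h2⟩ := ih (by omega)
      refine ⟨?_, ?_⟩
      · rw [← add_assoc, hidx, h1, h2]
        push_cast
        ring
      · rw [← add_assoc, hdrn _ ?_, h2]
        rw [add_assoc, Nat.dvd_add_right (Dvd.intro _ rfl)]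
        exact Nat.not_dvd_of_pos_of_lt (by omega) hj
  have hend : ∀ m, idx (T * (m + 1)) = idx (T * m) + drn (T * m) * (T * ψ : ℕ) := by
    intro m
    obtain ⟨h1, h2⟩ := hrun m (T - 1) (by omega)
    have h3 := hidx (T * m + (T - 1))
    rw [h1, h2] at h3
    have h4 : T * (m + 1) = T * m + (T - 1) + 1 := by rw [mul_add]; omega
    rw [h4, h3]
    have h5 : ((T * ψ : ℕ) : ℤ) = ((T - 1) * ψ : ℕ) + ψ := by
      have h6 : T * ψ = (T - 1) * ψ + ψ := by
        conv_lhs => rw [← Nat.sub_add_cancel (Nat.one_le_of_lt hT), add_mul, one_mul]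
      exact_mod_cast h6
    rw [h5]
    ring
  have hfar : ∀ m, T * ψ - T * σ ≤ Γ.dist (s.play r (T * m) 0) (c (idx (T * m))) := by
    intro m
    induction m with
    | zero => exact ht
    | succ m ih =>
      have h1 := (hesc _ _ ih).2
      rw [← hturn _ (Dvd.intro _ rfl), ← hend] at h1
      have h2 := s.dist_play_le hconn r 0 (T * m) T
      have h3 := hconn.dist_triangle (u := s.play r (T * m) 0) (v := s.play r (T * (m + 1)) 0)
        (w := c (idx (T * (m + 1))))
      rw [show T * (m + 1) = T * m + T by ring] at *
      omega
  refine ⟨r, ?_, fun k => ⟨idx k, rfl⟩⟩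
  rintro (⟨i, hi⟩ | ⟨k, w, hw, i, hi⟩)
  · have h1 := hfar 0
    rw [Fin.fin_one_eq_zero i, dist_comm] at hi
    have h2 : Γ.dist (s.play r 0 0) (c (idx 0)) ≤ ρ := hi
    rw [mul_zero] at h1
    omega
  · obtain ⟨a, ha, rfl⟩ := hqs k w hw
    rw [Fin.fin_one_eq_zero i, dist_comm] at hi
    have hk := Nat.div_add_mod k T
    set m := k / T
    set j := k % T
    have hj : j < T := Nat.mod_lt _ hT
    obtain ⟨h1, h2⟩ := hrun m j hj
    have h3 : (j + 1) * ψ ≤ T * ψ := Nat.mul_le_mul_right _ hj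
    have h4 : (j + 1) * σ ≤ T * σ := Nat.mul_le_mul_right _ hj
    have h5 := (hesc _ _ (hfar m)).1 (j * ψ + a) (by rw [add_mul] at h3; omega)
    rw [← hturn _ (Dvd.intro _ rfl)] at h5
    -- The cop moves first in each stage, so it has made `j + 1` moves when the robber is on its
    -- `j`-th path of the round.
    have h6 := s.dist_play_le hconn r 0 (T * m) (j + 1)
    rw [← add_assoc, hk] at h6
    have h7 : idx k + drn k * a = idx (T * m) + drn (T * m) * (j * ψ + a : ℕ) := by
      rw [← hk, h1, h2]
      push_cast
      ring
    rw [h7] at hi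
    have h8 := hconn.dist_triangle (u := s.play r (T * m) 0) (v := s.play r (k + 1) 0)
      (w := c (idx (T * m) + drn (T * m) * (j * ψ + a : ℕ)))
    omega

theorem exists_hasShortcuts {V : Type*} {Γ : SimpleGraph V} (hconn : Γ.Connected)
    (h : Γ.strongCopNumber = 1) : ∃ K, Γ.HasShortcuts K := by
  rw [strongCopNumber_eq_one_iff] at h
  obtain ⟨v⟩ := hconn.nonempty
  obtain ⟨σ, hσ, h⟩ := h v
  obtain ⟨ρ, hρ, h⟩ := h (6 * σ) (by omega)
  -- With `ψ = 6 * σ`, evasion needs `3 * ρ < 2 * (T * σ)`.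
  obtain ⟨T, hT⟩ : ∃ T, T = 2 * ρ + 1 := ⟨_, rfl⟩
  refine ⟨2 * (T * (6 * σ)), fun x p hp => ?_⟩
  by_contra! hno
  -- This ball contains all of `p`, so a robber running round `p` never leaves it.
  obtain ⟨s, hs⟩ := h (Γ.dist v x + p.length) (by omega)
  set n := p.length with hn
  have hn0 : (0 : ℤ) < n := by omega
  have hTσ : T ≤ T * σ := Nat.le_mul_of_pos_right T hσ
  have hmul : T * (6 * σ) = 6 * (T * σ) := by ring
  obtain ⟨r, hr, hrc⟩ := s.exists_evasion hconn (ρ := ρ) (ψ := 6 * σ) (T := T)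
    (c := fun i => p.getVert (i % n).toNat) (by omega) (by omega) (by
      -- The segment from `i` to `j` is shorter than `n`, so it wraps around at most once and is an
      -- initial segment of a rotation of `p`.
      intro i j hij hj
      have hi1 := Int.emod_nonneg i hn0.ne'
      have hi2 := Int.emod_lt_of_pos i hn0
      obtain ⟨a, ha⟩ := Int.eq_ofNat_of_zero_le hi1
      obtain ⟨k, hk⟩ := Int.eq_ofNat_of_zero_le (sub_nonneg.2 hij)
      have h1 : j % n = (a + k : ℤ) % n := by
        rw [← ha, ← hk, Int.emod_add_emod]
        congr 1
        ring
      have h2 : p.getVert (j % n).toNat = ((p.drop a).append (p.take a)).getVert k := by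
        rw [Walk.getVert_append, Walk.drop_length, ← hn]
        split_ifs with hlt
        · rw [h1, Int.emod_eq_of_lt (by omega) (by omega), Walk.drop_getVert]
          congr 1
        · have h3 : (a + k : ℤ) % n = a + k - n := by
            rw [← Int.sub_emod_right, Int.emod_eq_of_lt (by omega) (by omega)]
          rw [h1, h3, Walk.take_getVert]
          congr 1
          omega
      have h3 : p.getVert (i % n).toNat = p.getVert a := by rw [ha]; rfl
      have h4 := hno a k (by omega)
      have h5 := ((p.drop a).append (p.take a)).dist_getVert_le (Nat.zero_le k)
      rw [Walk.getVert_zero] at h5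
      show (Γ.dist (p.getVert (i % n).toNat) (p.getVert (j % n).toNat) : ℤ) = j - i
      rw [h2, h3, hk]
      omega)
  rcases hs r with hcap | ⟨N, hN⟩
  · exact hr hcap
  · have h1 := hN N le_rfl _ (Walk.start_mem_support _)
    obtain ⟨i, hi⟩ := hrc N
    rw [← hi] at h1
    have h2 := Walk.dist_left_le (p.getVert_mem_support (i % n).toNat)
    have h3 := hconn.dist_triangle (u := v) (v := x) (w := p.getVert (i % n).toNat)
    simp only at h1
    omega

/-! ### The Morse lemma -/

/-- Morse lemma, first half: geodesics stay close to quasigeodesics. -/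
theorem HasShortcuts.exists_dist_le_of_geodesic {V : Type*} {Γ : SimpleGraph V}
    (hc : Γ.Connected) {K : ℕ} (hK : Γ.HasShortcuts K) {x y : V} (q : Γ.Walk x y)
    (hq : ∀ i j, i ≤ j → j ≤ q.length → j - i ≤ 3 * Γ.dist (q.getVert i) (q.getVert j))
    {p : Γ.Walk x y} (hp : p.IsGeodesic) {t : ℕ} (ht : t ≤ p.length) :
    ∃ j ≤ q.length, Γ.dist (p.getVert t) (q.getVert j) ≤ 288 * K ^ 2 + 1 := by
  classical
  have hex : ∃ D, ∀ t ≤ p.length, ∃ j ≤ q.length, Γ.dist (p.getVert t) (q.getVert j) ≤ D := by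
    refine ⟨p.length, fun t ht => ⟨0, Nat.zero_le _, ?_⟩⟩
    rw [Walk.getVert_zero, dist_comm]
    exact Walk.dist_left_le (Walk.getVert_mem_support _ _)
  obtain ⟨D, hD, hmin⟩ : ∃ D, (∀ t ≤ p.length, ∃ j ≤ q.length,
      Γ.dist (p.getVert t) (q.getVert j) ≤ D) ∧ ∀ D' < D, ¬ ∀ t ≤ p.length, ∃ j ≤ q.length,
      Γ.dist (p.getVert t) (q.getVert j) ≤ D' :=
    ⟨Nat.find hex, Nat.find_spec hex, fun D' h => Nat.find_min hex h⟩
  suffices hle : D ≤ 288 * K ^ 2 + 1 by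
    obtain ⟨j, hj, h⟩ := hD t ht
    exact ⟨j, hj, h.trans hle⟩
  rcases Nat.eq_zero_or_pos D with h0 | hpos
  · omega
  -- By minimality of `D`, some vertex of `p` has distance at least `D` from `q`.
  have hneg := hmin (D - 1) (by omega)
  push Not at hneg
  obtain ⟨t, ht, hfar⟩ := hneg
  have hfar' : ∀ j ≤ q.length, D ≤ Γ.dist (q.getVert j) (p.getVert t) := fun j hj => by
    have := hfar j hj
    rw [dist_comm]
    omega
  have hside : ∀ i ≤ p.length, (i = 0 ∨ i = p.length ∨ 2 * D ≤ Γ.dist (p.getVert i) (p.getVert t)) →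
      ∃ j ≤ q.length, ∃ s : Γ.Walk (p.getVert i) (q.getVert j), s.length ≤ D ∧
        ∀ u ∈ s.support, D ≤ Γ.dist u (p.getVert t) := by
    rintro i hi (rfl | rfl | h)
    · refine ⟨0, Nat.zero_le _, Walk.nil.copy rfl (by simp), by simp, fun u hu => ?_⟩
      have : u = q.getVert 0 := by simpa using hu
      rw [this]
      exact hfar' 0 (Nat.zero_le _)
    · refine ⟨q.length, le_rfl, Walk.nil.copy rfl (by simp), by simp, fun u hu => ?_⟩
      have : u = q.getVert q.length := by simpa using hu
      rw [this]
      exact hfar' _ le_rfl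
    · obtain ⟨j, hj, hd⟩ := hD i hi
      obtain ⟨s, hs⟩ := hc.exists_walk_length_eq_dist (p.getVert i) (q.getVert j)
      refine ⟨j, hj, s, hs ▸ hd, fun u hu => ?_⟩
      have h1 := Walk.dist_left_le hu
      have h2 := hc.dist_triangle (u := p.getVert i) (v := u) (w := p.getVert t)
      omega
  have hmid : ∀ i ≤ q.length, ∀ j ≤ q.length, ∃ s : Γ.Walk (q.getVert i) (q.getVert j),
      s.length ≤ 3 * Γ.dist (q.getVert i) (q.getVert j) ∧ ∀ u ∈ s.support, u ∈ q.support := by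
    intro i hi j hj
    rcases le_total i j with h | h
    · obtain ⟨s, hs, hsq⟩ := q.exists_subwalk h
      exact ⟨s, hs.trans (hq i j h hj), hsq⟩
    · obtain ⟨s, hs, hsq⟩ := q.exists_subwalk h
      refine ⟨s.reverse, ?_, fun u hu => hsq u (by simpa using hu)⟩
      rw [Walk.length_reverse, dist_comm]
      exact hs.trans (hq j i h hi)
  -- The detour leaves `p` at distance `2 * D` on either side, or at an end of `p`, which already
  -- lies on `q`.
  obtain ⟨a, ha⟩ : ∃ a, a = t - 2 * D := ⟨_, rfl⟩
  obtain ⟨b, hb⟩ : ∃ b, b = min p.length (t + 2 * D) := ⟨_, rfl⟩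
  have hat := hp.dist_getVert hc (i := a) (j := t) (by omega) ht
  have htb := hp.dist_getVert hc (i := t) (j := b) (by omega) (by omega)
  have hab := hp.dist_getVert hc (i := a) (j := b) (by omega) (by omega)
  obtain ⟨i, hi, s, hs, hs'⟩ := hside a (by omega) (by omega)
  obtain ⟨j, hj, s₂, hs₂, hs₂'⟩ := hside b (by omega) (by
    rw [dist_comm, htb]
    omega)
  obtain ⟨s₁, hs₁, hs₁'⟩ := hmid j hj i hi
  have hij : Γ.dist (q.getVert j) (q.getVert i) ≤ 6 * D := by
    have h1 := hc.dist_triangle (u := q.getVert j) (v := p.getVert b) (w := q.getVert i)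
    have h2 := hc.dist_triangle (u := p.getVert b) (v := p.getVert a) (w := q.getVert i)
    have h3 := Γ.dist_le s
    have h4 := Γ.dist_le s₂
    rw [dist_comm] at h4
    rw [dist_comm (u := p.getVert b) (v := p.getVert a)] at h2
    omega
  have hsq := hK.sq_le hc (a := p.getVert a) (p := p.getVert t) (b := p.getVert b) (by omega)
    (s₂.append (s₁.append s.reverse)) (m := D / 2) (fun u hu => by
      rw [Walk.mem_support_append_iff, Walk.mem_support_append_iff, Walk.support_reverse,
        List.mem_reverse] at hu
      have : D ≤ Γ.dist u (p.getVert t) := by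
        rcases hu with hu | hu | hu
        · exact hs₂' u hu
        · obtain ⟨k, hk, rfl⟩ := Walk.exists_getVert (hs₁' u hu)
          exact hfar' k hk
        · exact hs' u hu
      omega)
  rw [Walk.length_append, Walk.length_append, Walk.length_reverse] at hsq
  -- The terms are bounded by `4 * D`, `D`, `3 * (6 * D)` and `D`; a linear length against the
  -- quadratic lower bound limits `D`.
  have hlen : Γ.dist (p.getVert a) (p.getVert b) + (s₂.length + (s₁.length + s.length)) ≤
      24 * D := by omega
  obtain ⟨m, hm⟩ : ∃ m, m = D / 2 := ⟨_, rfl⟩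
  rw [← hm] at hsq
  have h1 := hsq.trans (Nat.mul_le_mul_left (2 * K ^ 2) hlen)
  rcases Nat.eq_zero_or_pos m with h0 | hmpos
  · omega
  have h2 : m * m ≤ m * (144 * K ^ 2) := by
    calc m * m = m ^ 2 := (sq m).symm
      _ ≤ 2 * K ^ 2 * (24 * D) := h1
      _ ≤ 2 * K ^ 2 * (24 * (3 * m)) := by gcongr; omega
      _ = m * (144 * K ^ 2) := by ring
  have h3 := Nat.le_of_mul_le_mul_left h2 hmpos
  omega

/-- Morse lemma, second half: quasigeodesics stay close to geodesics. -/
theorem HasShortcuts.exists_dist_le_of_quasigeodesic {V : Type*} {Γ : SimpleGraph V}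
    (hc : Γ.Connected) {K : ℕ} (hK : Γ.HasShortcuts K) {x y : V} (q : Γ.Walk x y)
    (hq : ∀ i j, i ≤ j → j ≤ q.length → j - i ≤ 3 * Γ.dist (q.getVert i) (q.getVert j))
    {p : Γ.Walk x y} (hp : p.IsGeodesic) {u : V} (hu : u ∈ q.support) :
    ∃ w ∈ p.support, Γ.dist u w ≤ 7 * (288 * K ^ 2 + 1) + 3 := by
  have hD := fun t (ht : t ≤ p.length) => hK.exists_dist_le_of_geodesic hc q hq hp ht
  obtain ⟨D, hDe⟩ : ∃ D, D = 288 * K ^ 2 + 1 := ⟨_, rfl⟩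
  rw [← hDe] at hD ⊢
  obtain ⟨i, hi, rfl⟩ := Walk.exists_getVert hu
  by_contra! hno
  -- A discrete continuity argument: if the nearby index on `q` jumped from `j ≤ i` to `k > i`, then
  -- `k - j ≤ 3 * (2 * D + 1)`, so `q.getVert i` would be within `7 * D + 3` of `p`. At the end of
  -- `p` this keeps `i` within `3 * D` of the end of `q`.
  have hstep : ∀ t ≤ p.length, ∃ j ≤ i, Γ.dist (p.getVert t) (q.getVert j) ≤ D := by
    intro t
    induction t with
    | zero => exact fun _ => ⟨0, Nat.zero_le _, by simp⟩
    | succ t ih =>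
      intro ht
      obtain ⟨j, hj, hjd⟩ := ih (by omega)
      obtain ⟨k, hk, hkd⟩ := hD (t + 1) ht
      rcases le_or_gt k i with h | h
      · exact ⟨k, h, hkd⟩
      exfalso
      have h1 := hq j k (by omega) hk
      have h2 := hc.dist_triangle (u := q.getVert j) (v := p.getVert t) (w := q.getVert k)
      have h3 := hc.dist_triangle (u := p.getVert t) (v := p.getVert (t + 1)) (w := q.getVert k)
      have h4 := p.dist_getVert_le (Nat.le_add_right t 1)
      have h5 := hc.dist_triangle (u := q.getVert i) (v := q.getVert j) (w := p.getVert t)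
      have h6 := q.dist_getVert_le hj
      have h7 := hno _ (p.getVert_mem_support t)
      rw [dist_comm] at h6
      rw [dist_comm (u := q.getVert j) (v := p.getVert t)] at h2 h5
      omega
  obtain ⟨j, hj, hjd⟩ := hstep p.length le_rfl
  have h1 := hq j q.length (by omega) le_rfl
  have h2 := hno _ (p.getVert_mem_support p.length)
  have h3 := q.dist_getVert_le hi
  rw [Walk.getVert_length] at *
  rw [dist_comm] at hjd
  omega

/-! ### Slim triangles from shortcuts -/

/-- Following `a` to `w` and then a geodesic to `y` is quasigeodesic with constant 3: for `u` on `a`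
and `v` on the second part, the choice of `w` gives `d(w, v) ≤ d(u, v)`, hence `d(u, w) ≤ 2 d(u,
v)`. -/
theorem HasShortcuts.exists_dist_le_of_projection {V : Type*} {Γ : SimpleGraph V}
    (hc : Γ.Connected) {K : ℕ} (hK : Γ.HasShortcuts K) {x y w : V} {p : Γ.Walk x y}
    (hp : p.IsGeodesic) {a : Γ.Walk x w} (ha : a.IsGeodesic)
    (hw : ∀ u ∈ a.support, Γ.dist w y ≤ Γ.dist u y) {u : V} (hu : u ∈ a.support) :
    ∃ v ∈ p.support, Γ.dist u v ≤ 7 * (288 * K ^ 2 + 1) + 3 := by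
  obtain ⟨b, hb⟩ := hc.exists_walk_length_eq_dist w y
  have hbg : b.IsGeodesic := hb
  refine hK.exists_dist_le_of_quasigeodesic hc (a.append b) (fun i j hij hj => ?_) hp
    (by rw [Walk.mem_support_append_iff]; exact Or.inl hu)
  rw [Walk.length_append] at hj
  rw [Walk.getVert_append, Walk.getVert_append]
  split_ifs with h1 h2 h2
  · rw [ha.dist_getVert hc hij h2.le]
    omega
  · have h3 := ha.dist_right hc h1.le
    have h4 := hbg.dist_left hc (i := j - a.length) (by omega)
    have h5 := hbg.dist_right hc (i := j - a.length) (by omega)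
    have h6 := hw _ (a.getVert_mem_support i)
    have h7 := hc.dist_triangle (u := a.getVert i) (v := b.getVert (j - a.length)) (w := y)
    have h8 := hc.dist_triangle (u := a.getVert i) (v := b.getVert (j - a.length)) (w := w)
    rw [dist_comm (u := b.getVert (j - a.length)) (v := w)] at h8
    omega
  · omega
  · rw [hbg.dist_getVert hc (by omega) (by omega)]
    omega

theorem HasShortcuts.isHyperbolic {V : Type*} {Γ : SimpleGraph V} (hc : Γ.Connected) {K : ℕ}
    (hK : Γ.HasShortcuts K) : Γ.IsHyperbolic := by
  refine ⟨7 * (288 * K ^ 2 + 1) + 3, fun x y z p q r hp hq hr u hu => ?_⟩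
  -- The side `r` is cut at a vertex nearest to `y`; one half stays close to `p`, the other to `q`.
  obtain ⟨k, hk, hmin⟩ := Finset.exists_min_image (Finset.range (r.length + 1))
    (fun k => Γ.dist (r.getVert k) y) ⟨0, by simp⟩
  have hk' : k ≤ r.length := Nat.lt_succ_iff.1 (Finset.mem_range.1 hk)
  have hw : ∀ v ∈ r.support, Γ.dist (r.getVert k) y ≤ Γ.dist v y := by
    intro v hv
    obtain ⟨i, hi, rfl⟩ := Walk.exists_getVert hv
    exact hmin i (Finset.mem_range.2 (by omega))
  have h1 : (r.take k).IsGeodesic := length_eq_dist_of_subwalk hr (r.isSubwalk_take k)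
  have h2 : (r.drop k).reverse.IsGeodesic := by
    unfold Walk.IsGeodesic
    rw [Walk.length_reverse, dist_comm]
    exact length_eq_dist_of_subwalk hr (r.isSubwalk_drop k)
  rw [← r.append_take_drop_eq k, Walk.mem_support_append_iff] at hu
  rcases hu with hu | hu
  · obtain ⟨v, hv, hd⟩ := hK.exists_dist_le_of_projection hc hp h1
      (fun v hv => hw v ((r.isSubwalk_take k).support_subset hv)) hu
    exact ⟨v, Or.inl hv, hd⟩
  · have h3 : q.reverse.IsGeodesic := by
      unfold Walk.IsGeodesic
      rw [Walk.length_reverse, dist_comm]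
      exact hq
    obtain ⟨v, hv, hd⟩ := hK.exists_dist_le_of_projection hc h3 h2
      (fun v hv => hw v ((r.isSubwalk_drop k).support_subset (by simpa using hv)))
      (by simpa using hu)
    exact ⟨v, Or.inr (by simpa using hv), hd⟩

theorem isHyperbolic_iff_strongCopNumber_eq_one {V : Type*} {Γ : SimpleGraph V}
    (hc : Γ.Connected) : Γ.IsHyperbolic ↔ Γ.strongCopNumber = 1 := by
  refine ⟨fun h => h.strongCopNumber_eq_one hc, fun h => ?_⟩
  obtain ⟨K, hK⟩ := exists_hasShortcuts hc h
  exact hK.isHyperbolic hc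

/-! ### Cayley graphs and the main theorem -/

theorem mulCayley_connected {G : Type*} [Group G] {S : Set G} (hS : Subgroup.closure S = ⊤) :
    (mulCayley S).Connected := by
  have h : ∀ g : G, ∀ a : G, (mulCayley S).Reachable a (a * g) := by
    intro g
    have hg : g ∈ Subgroup.closure S := by rw [hS]; trivial
    induction hg using Subgroup.closure_induction with
    | mem g hg =>
      intro a
      by_cases ha : a = a * g
      · rw [← ha]
      · exact Adj.reachable ((mulCayley_adj' S _ _).2 ⟨ha, g, hg, Or.inl rfl⟩)
    | one => intro a; rw [mul_one]
    | mul g k _ _ hg hk => intro a; rw [← mul_assoc]; exact (hg a).trans (hk _)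
    | inv g _ hg => intro a; simpa using (hg (a * g⁻¹)).symm
  have : Nonempty G := ⟨1⟩
  exact ⟨fun a b => by simpa using h (a⁻¹ * b) a⟩

theorem mulCayley_dist_mul_left_le {G : Type*} [Group G] {S : Set G}
    (hS : Subgroup.closure S = ⊤) (a u v : G) :
    (mulCayley S).dist (a * u) (a * v) ≤ (mulCayley S).dist u v := by
  obtain ⟨p, hp⟩ := (mulCayley_connected hS).exists_walk_length_eq_dist u v
  let φ : mulCayley S →g mulCayley S := ⟨fun x => a * x, fun h => mulCayley_adj_mul_iff_right.2 h⟩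
  rw [← hp, ← p.length_map φ]
  exact dist_le _

theorem dist_le_mul_dist {V : Type*} {Γ Γ' : SimpleGraph V} (hc : Γ.Connected)
    (hc' : Γ'.Connected) {C : ℕ} (h : ∀ u v, Γ.Adj u v → Γ'.dist u v ≤ C) (u v : V) :
    Γ'.dist u v ≤ C * Γ.dist u v := by
  obtain ⟨p, hp⟩ := hc.exists_walk_length_eq_dist u v
  rw [← hp]
  clear hp
  induction p with
  | nil => simp
  | @cons u v w e p ih =>
    have h1 := hc'.dist_triangle (u := u) (v := v) (w := w)
    have h2 := h u v e
    rw [Walk.length_cons, mul_add]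
    omega

theorem exists_mulCayley_dist_le {G : Type*} [Group G] {S S' : Set G} (hf : S.Finite)
    (hS : Subgroup.closure S = ⊤) (hS' : Subgroup.closure S' = ⊤) :
    ∃ C, ∀ u v, (mulCayley S').dist u v ≤ C * (mulCayley S).dist u v := by
  obtain ⟨C, hC⟩ := (hf.image fun g => (mulCayley S').dist 1 g).bddAbove
  have hgen : ∀ g ∈ S, ∀ a : G, (mulCayley S').dist a (a * g) ≤ C := fun g hg a => by
    have h1 := mulCayley_dist_mul_left_le hS' a 1 g
    rw [mul_one] at h1
    exact h1.trans (hC ⟨g, hg, rfl⟩)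
  refine ⟨C, dist_le_mul_dist (mulCayley_connected hS) (mulCayley_connected hS') ?_⟩
  intro u v h
  obtain ⟨-, g, hg, rfl | rfl⟩ := (mulCayley_adj' S u v).1 h
  · exact hgen g hg u
  · rw [dist_comm]
    exact hgen g hg v

theorem mulCayley_strongCopNumber_eq_one {G : Type*} [Group G] {S S' : Set G} (hf : S.Finite)
    (hf' : S'.Finite) (hS : Subgroup.closure S = ⊤) (hS' : Subgroup.closure S' = ⊤)
    (h : (mulCayley S).strongCopNumber = 1) : (mulCayley S').strongCopNumber = 1 := by
  obtain ⟨C, hC⟩ := exists_mulCayley_dist_le hf hS hS'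
  obtain ⟨C', hC'⟩ := exists_mulCayley_dist_le hf' hS' hS
  refine strongCopNumber_eq_one_of_dist_le (mulCayley_connected hS) (mulCayley_connected hS')
    (C := C + C' + 1) (by omega) (fun u v => (hC u v).trans ?_) (fun u v => (hC' u v).trans ?_) h
  · exact Nat.mul_le_mul_right _ (by omega)
  · exact Nat.mul_le_mul_right _ (by omega)

end SimpleGraph

theorem theoremA :
    (∀ (V : Type*) (Γ : SimpleGraph V), Γ.Connected →
      (Γ.IsHyperbolic ↔ Γ.strongCopNumber = 1)) ∧
    (∀ (G : Type*) [Group G] [Group.FG G] (S : Set G), S.Finite → Subgroup.closure S = ⊤ →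
      (IsHyperbolicGroup G ↔ (SimpleGraph.mulCayley S).strongCopNumber = 1)) := by
  refine ⟨fun V Γ hc => SimpleGraph.isHyperbolic_iff_strongCopNumber_eq_one hc, ?_⟩
  intro G _ _ S hf hS
  refine ⟨fun h => (h S hf hS).strongCopNumber_eq_one (SimpleGraph.mulCayley_connected hS),
    fun h S' hf' hS' => ?_⟩
  -- The generating set is changed on the side of the cop number, so quasi-isometry invariance of
  -- hyperbolicity is not needed.
  rw [SimpleGraph.isHyperbolic_iff_strongCopNumber_eq_one (SimpleGraph.mulCayley_connected hS')]
  exact SimpleGraph.mulCayley_strongCopNumber_eq_one hf hf' hS hS' h
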